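/- A \emph{symmetric triple} $(\mathfrak g,\sigma,B)$ consists of a finite-dimensional real Lie algebra $\mathfrak g$, an involutive automorphism $\sigma$ of $\mathfrak g$ with eigenspaces $\mathfrak h$ (for $+1$) and $\mathfrak m$ (for $-1$) satisfying $\mathfrak h=[\mathfrak m,\mathfrak m]$, and a non-degenerate symmetric bilinear form $B$ on $\mathfrak g$ invariant under $\sigma$ and $\mathrm{ad}(\mathfrak g)$. It is \emph{decomposable} if $\mathfrak m$ contains a subspace $V\neq 0,\mathfrak m$ that is $\mathrm{ad}(\mathfrak h)$-invariant and on which $B$ is non-degenerate, and \emph{indecomposable} otherwise. An isomorphism of symmetric triples is a Lie algebra isomorphism $\Phi$ with $\Phi\sigma_1=\sigma_2\Phi$ and $B_1=\Phi^*B_2$. Let $n\ge 4$, $\epsilon_Y\in\{\pm1\}$, $r\in\{0,\dots,n-4\}$, and let $\lambda_1,\lambda_2\in\mathbb R^{n-4}$ satisfy $(\lambda_1^\alpha,\lambda_2^\alpha)\neq(0,0)$ for all $\alpha$. Put $\epsilon_\alpha=-1$ for $\alpha\le r$ and $\epsilon_\alpha=+1$ for $\alpha>r$. The symmetric triple $\tau_n(\epsilon_Y,r,\lambda)$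 has basis $y,W_1^*,\dots,W_{n-4}^*$ of $\mathfrak h$ and $Z_1,Z_2,W_1,\dots,W_{n-4},Z_1^*,Z_2^*$ of $\mathfrak m$. Its form is given by $B(y,y)=\epsilon_Y$, $B(W_\alpha^*,W_\beta^*)=\delta_{\alpha\beta}\epsilon_\alpha$, $B(W_\alpha,W_\beta)=\delta_{\alpha\beta}$, $B(Z_i,Z_j^*)=\delta_{ij}$, all other products of basis vectors being $0$. Its brackets are $$[Z_1^*,Z_2^*]=y,\quad [Z_i^*,W_\alpha]=\lambda_i^\alpha W_\alpha^*,\quad [y,Z_1^*]=\epsilon_Y Z_2,\quad [y,Z_2^*]=-\epsilon_Y Z_1,$$ $$[W_\alpha^*,Z_i^*]=\epsilon_\alpha\lambda_i^\alpha W_\alpha,\quad [W_\alpha^*,W_\beta]=-\delta_{\alpha\beta}\epsilon_\alpha(\lambda_1^\alpha Z_1+\lambda_2^\alpha Z_2),$$ all other brackets of basis vectors (up to skew-symmetry) being $0$. \textbf{Proposition.} The isomorphism classes of the indecomposable triples $\tau_n(\epsilon_Y,r,\lambda)$ with $(\lambda_1,\lambda_2)$ of rank $1$ are in one-to-one correspondence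 with the triples $$(\epsilon_Y,r,[\lambda_1]),\qquad \epsilon_Y\in\{\pm1\},\quad r\in\{0,\dots,n-4\},\quad [\lambda_1]\in\Big\{v\in S^{n-5}\subset\mathbb R^{n-4}: v\notin\bigcup_\alpha e_\alpha^\perp\Big\}\Big/G_r .$$ Here $G_r$ is the group of transformations of $\mathbb R^{n-4}$ generated by the coordinate permutations that preserve the partition $\{1,\dots,r\}\cup\{r+1,\dots,n-4\}$ and by all sign changes of coordinates. The correspondence sends $(\epsilon_Y,r,[\lambda_1])$ to the isomorphism class of $\tau_n(\epsilon_Y,r,(\lambda_1,0))$; in particular this triple is indecomposable and its class depends only on $(\epsilon_Y,r,[\lambda_1])$. If such triples with $(\lambda_1,\lambda_2)$ of rank $1$ exist, then $n>4$. -/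

import Mathlib

noncomputable section

/-! Symmetric triples -/

/-- A symmetric triple `(𝔤, σ, B)`: a finite dimensional real Lie algebra `𝔤`, an involutive
automorphism `σ` (a Lie algebra endomorphism with `σ ∘ σ = id`), and a nondegenerate symmetric
bilinear form `B` invariant under `σ` and `ad 𝔤`, such that `𝔥 = [𝔪, 𝔪]`, where `𝔥` and `𝔪` are
the eigenspaces of `σ` for `+1` and `-1`. -/
structure SymmetricTriple : Type 1 where
  carrier : Type
  [lieRing : LieRing carrier]
  [lieAlgebra : LieAlgebra ℝ carrier]
  [finiteDimensional : FiniteDimensional ℝ carrier]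
  σ : carrier →ₗ⁅ℝ⁆ carrier
  B : LinearMap.BilinForm ℝ carrier
  σ_involutive : ∀ x, σ (σ x) = x
  B_symm : ∀ x y, B x y = B y x
  B_nondegenerate : ∀ x, (∀ y, B x y = 0) → x = 0
  B_σ : ∀ x y, B (σ x) (σ y) = B x y
  B_ad : ∀ x y z : carrier, B ⁅x, y⁆ z = -B y ⁅x, z⁆
  fixed_eq_span : {x | σ x = x} =
    (Submodule.span ℝ {u | ∃ x y : carrier, σ x = -x ∧ σ y = -y ∧ u = ⁅x, y⁆} : Set carrier)

namespace SymmetricTriple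

attribute [instance] SymmetricTriple.lieRing
attribute [instance] SymmetricTriple.lieAlgebra
attribute [instance] SymmetricTriple.finiteDimensional

/-- The `+1` eigenspace `𝔥` of `σ`. -/
def h (τ : SymmetricTriple) : Submodule ℝ τ.carrier where
  carrier := {x | τ.σ x = x}
  add_mem' := by intro a b ha hb; simp_all
  zero_mem' := by simp
  smul_mem' := by intro c x hx; simp_all

/-- The `-1` eigenspace `𝔪` of `σ`. -/
def m (τ : SymmetricTriple) : Submodule ℝ τ.carrier where
  carrier := {x | τ.σ x = -x}
  add_mem' := by intro a b ha hb; simp_all [add_comm]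
  zero_mem' := by simp
  smul_mem' := by intro c x hx; simp_all

/-- The triple is decomposable: `𝔪` contains a subspace, neither `0` nor `𝔪`, which is
`ad 𝔥`-invariant and on which `B` is nondegenerate. -/
def Decomposable (τ : SymmetricTriple) : Prop :=
  ∃ V : Submodule ℝ τ.carrier, V ≤ τ.m ∧ V ≠ ⊥ ∧ V ≠ τ.m ∧
    (∀ v ∈ V, (∀ w ∈ V, τ.B v w = 0) → v = 0) ∧
    (∀ x ∈ τ.h, ∀ v ∈ V, ⁅x, v⁆ ∈ V)

def Indecomposable (τ : SymmetricTriple) : Prop := ¬ τ.Decomposable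

/-- Isomorphy of symmetric triples: a Lie algebra isomorphism that intertwines the involutions and
pulls the second bilinear form back to the first. -/
def Isomorphic (τ₁ τ₂ : SymmetricTriple) : Prop :=
  ∃ Φ : τ₁.carrier ≃ₗ⁅ℝ⁆ τ₂.carrier,
    (∀ x, Φ (τ₁.σ x) = τ₂.σ (Φ x)) ∧ (∀ x y, τ₁.B x y = τ₂.B (Φ x) (Φ y))

theorem isomorphic_equivalence : Equivalence Isomorphic where
  refl τ := ⟨LieEquiv.refl, fun _ => rfl, fun _ _ => rfl⟩
  symm := by
    rintro τ₁ τ₂ ⟨Φ, h1, h2⟩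
    refine ⟨Φ.symm, fun x => ?_, fun x y => ?_⟩
    · have h3 := h1 (Φ.symm x)
      rw [LieEquiv.apply_symm_apply] at h3
      rw [← h3, LieEquiv.symm_apply_apply]
    · rw [h2]; simp
  trans := by
    rintro τ₁ τ₂ τ₃ ⟨Φ, h1, h2⟩ ⟨Ψ, h3, h4⟩
    refine ⟨Φ.trans Ψ, fun x => ?_, fun x y => ?_⟩
    · simp [h1, h3]
    · simp [h2, h4]

def isoSetoid : Setoid SymmetricTriple := ⟨Isomorphic, isomorphic_equivalence⟩

/-- Isomorphism classes of symmetric triples. -/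
def IsoClass : Type 1 := Quotient isoSetoid

def isoClass (τ : SymmetricTriple) : IsoClass := Quotient.mk isoSetoid τ

end SymmetricTriple

/-! The normal form. The number `s` stands for `n - 4`, where `n = dim 𝔪`. -/

/-- The sign `-1` for the first `r` indices and `+1` for the others. -/
def epsSign (r : ℕ) {s : ℕ} (α : Fin s) : ℝ := if (α : ℕ) < r then -1 else 1

theorem epsSign_ne_zero (r : ℕ) {s : ℕ} (α : Fin s) : epsSign r α ≠ 0 := by
  unfold epsSign; split_ifs <;> norm_num

/-- The vector space `𝔥 ⊕ 𝔪` of the normal form with parameters `ε_Y = ε`, `r` and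
`l i α = λ_i^α` (`i = 0, 1`): an element `((a, p), (z, w, t))` is the vector
`a y + ∑ p_α W_α* + ∑ z_i Z_i + ∑ w_α W_α + ∑ t_i Z_i*`. -/
def TauAlg (s : ℕ) (_ε : ℤˣ) (_r : ℕ) (_l : Fin 2 → Fin s → ℝ) : Type :=
  (ℝ × (Fin s → ℝ)) × ((Fin 2 → ℝ) × (Fin s → ℝ) × (Fin 2 → ℝ))

namespace TauAlg

variable {s : ℕ} {ε : ℤˣ} {r : ℕ} {l : Fin 2 → Fin s → ℝ}

instance : AddCommGroup (TauAlg s ε r l) :=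
  inferInstanceAs (AddCommGroup ((ℝ × (Fin s → ℝ)) × ((Fin 2 → ℝ) × (Fin s → ℝ) × (Fin 2 → ℝ))))

instance : Module ℝ (TauAlg s ε r l) :=
  inferInstanceAs (Module ℝ ((ℝ × (Fin s → ℝ)) × ((Fin 2 → ℝ) × (Fin s → ℝ) × (Fin 2 → ℝ))))

instance : FiniteDimensional ℝ (TauAlg s ε r l) :=
  inferInstanceAs
    (FiniteDimensional ℝ ((ℝ × (Fin s → ℝ)) × ((Fin 2 → ℝ) × (Fin s → ℝ) × (Fin 2 → ℝ))))

/-- The vector with the given coordinates. -/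
def mk (a : ℝ) (p : Fin s → ℝ) (z : Fin 2 → ℝ) (w : Fin s → ℝ) (t : Fin 2 → ℝ) :
    TauAlg s ε r l := ((a, p), (z, w, t))

/-- Coordinate with respect to `y`. -/
def cy (x : TauAlg s ε r l) : ℝ := x.1.1
/-- Coordinates with respect to the `W_α*`. -/
def cp (x : TauAlg s ε r l) : Fin s → ℝ := x.1.2
/-- Coordinates with respect to the `Z_i`. -/
def cz (x : TauAlg s ε r l) : Fin 2 → ℝ := x.2.1
/-- Coordinates with respect to the `W_α`. -/
def cw (x : TauAlg s ε r l) : Fin s → ℝ := x.2.2.1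
/-- Coordinates with respect to the `Z_i*`. -/
def ct (x : TauAlg s ε r l) : Fin 2 → ℝ := x.2.2.2

theorem ext' {x y : TauAlg s ε r l} (h1 : x.cy = y.cy) (h2 : ∀ α, x.cp α = y.cp α)
    (h3 : x.cz 0 = y.cz 0) (h3' : x.cz 1 = y.cz 1)
    (h4 : ∀ α, x.cw α = y.cw α) (h5 : x.ct 0 = y.ct 0) (h5' : x.ct 1 = y.ct 1) : x = y := by
  refine Prod.ext (Prod.ext h1 (funext h2)) (Prod.ext (funext ?_) (Prod.ext (funext h4)
    (funext ?_)))
  · intro i; fin_cases i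
    · exact h3
    · exact h3'
  · intro i; fin_cases i
    · exact h5
    · exact h5'

section coords
variable (a : ℝ) (p w : Fin s → ℝ) (z t : Fin 2 → ℝ)
@[simp] theorem cy_mk : (mk a p z w t : TauAlg s ε r l).cy = a := rfl
@[simp] theorem cp_mk : (mk a p z w t : TauAlg s ε r l).cp = p := rfl
@[simp] theorem cz_mk : (mk a p z w t : TauAlg s ε r l).cz = z := rfl
@[simp] theorem cw_mk : (mk a p z w t : TauAlg s ε r l).cw = w := rfl
@[simp] theorem ct_mk : (mk a p z w t : TauAlg s ε r l).ct = t := rfl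
variable (x x' : TauAlg s ε r l) (c : ℝ)
@[simp] theorem cy_add : (x + x').cy = x.cy + x'.cy := rfl
@[simp] theorem cp_add : (x + x').cp = x.cp + x'.cp := rfl
@[simp] theorem cz_add : (x + x').cz = x.cz + x'.cz := rfl
@[simp] theorem cw_add : (x + x').cw = x.cw + x'.cw := rfl
@[simp] theorem ct_add : (x + x').ct = x.ct + x'.ct := rfl
@[simp] theorem cy_smul : (c • x).cy = c * x.cy := rfl
@[simp] theorem cp_smul : (c • x).cp = c • x.cp := rfl
@[simp] theorem cz_smul : (c • x).cz = c • x.cz := rfl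
@[simp] theorem cw_smul : (c • x).cw = c • x.cw := rfl
@[simp] theorem ct_smul : (c • x).ct = c • x.ct := rfl
@[simp] theorem cy_neg : (-x).cy = -x.cy := rfl
@[simp] theorem cp_neg : (-x).cp = -x.cp := rfl
@[simp] theorem cz_neg : (-x).cz = -x.cz := rfl
@[simp] theorem cw_neg : (-x).cw = -x.cw := rfl
@[simp] theorem ct_neg : (-x).ct = -x.ct := rfl
@[simp] theorem cy_zero : (0 : TauAlg s ε r l).cy = 0 := rfl
@[simp] theorem cp_zero : (0 : TauAlg s ε r l).cp = 0 := rfl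
@[simp] theorem cz_zero : (0 : TauAlg s ε r l).cz = 0 := rfl
@[simp] theorem cw_zero : (0 : TauAlg s ε r l).cw = 0 := rfl
@[simp] theorem ct_zero : (0 : TauAlg s ε r l).ct = 0 := rfl
end coords

/-- The bilinear skew-symmetric extension of the bracket table (with `ε_α = epsSign r α`)
`[Z_1*, Z_2*] = y`, `[Z_i*, W_α] = λ_i^α W_α*`, `[y, Z_1*] = ε Z_2`, `[y, Z_2*] = -ε Z_1`,
`[W_α*, Z_i*] = ε_α λ_i^α W_α`, `[W_α*, W_β] = -δ_{αβ} ε_α (λ_1^α Z_1 + λ_2^α Z_2)`,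
all other brackets of basis vectors being zero. -/
instance : Bracket (TauAlg s ε r l) (TauAlg s ε r l) where
  bracket x x' := mk
    (x.ct 0 * x'.ct 1 - x.ct 1 * x'.ct 0)
    (fun α => l 0 α * (x.ct 0 * x'.cw α - x'.ct 0 * x.cw α)
      + l 1 α * (x.ct 1 * x'.cw α - x'.ct 1 * x.cw α))
    ![-((ε : ℤ) : ℝ) * (x.cy * x'.ct 1 - x'.cy * x.ct 1)
        - ∑ α, epsSign r α * l 0 α * (x.cp α * x'.cw α - x'.cp α * x.cw α),
      ((ε : ℤ) : ℝ) * (x.cy * x'.ct 0 - x'.cy * x.ct 0)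
        - ∑ α, epsSign r α * l 1 α * (x.cp α * x'.cw α - x'.cp α * x.cw α)]
    (fun α => epsSign r α * (l 0 α * (x.cp α * x'.ct 0 - x'.cp α * x.ct 0)
      + l 1 α * (x.cp α * x'.ct 1 - x'.cp α * x.ct 1)))
    0

theorem bracket_def (x x' : TauAlg s ε r l) : ⁅x, x'⁆ = mk
    (x.ct 0 * x'.ct 1 - x.ct 1 * x'.ct 0)
    (fun α => l 0 α * (x.ct 0 * x'.cw α - x'.ct 0 * x.cw α)
      + l 1 α * (x.ct 1 * x'.cw α - x'.ct 1 * x.cw α))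
    ![-((ε : ℤ) : ℝ) * (x.cy * x'.ct 1 - x'.cy * x.ct 1)
        - ∑ α, epsSign r α * l 0 α * (x.cp α * x'.cw α - x'.cp α * x.cw α),
      ((ε : ℤ) : ℝ) * (x.cy * x'.ct 0 - x'.cy * x.ct 0)
        - ∑ α, epsSign r α * l 1 α * (x.cp α * x'.cw α - x'.cp α * x.cw α)]
    (fun α => epsSign r α * (l 0 α * (x.cp α * x'.ct 0 - x'.cp α * x.ct 0)
      + l 1 α * (x.cp α * x'.ct 1 - x'.cp α * x.ct 1)))
    0 := rfl

instance : LieRing (TauAlg s ε r l) where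
  add_lie x y z := by
    apply ext' <;> (try intro α) <;>
      simp only [bracket_def, cy_mk, cp_mk, cz_mk, cw_mk, ct_mk, cy_add, cp_add, cz_add, cw_add,
        ct_add, Pi.add_apply, Pi.zero_apply, Matrix.cons_val_zero, Matrix.cons_val_one, add_zero]
    · ring
    · ring
    · rw [show ∀ a b c d : ℝ, a - b + (c - d) = a + c - (b + d) by intros; ring,
        ← Finset.sum_add_distrib]
      congr 1
      · ring
      · exact Finset.sum_congr rfl fun _ _ => by ring
    · rw [show ∀ a b c d : ℝ, a - b + (c - d) = a + c - (b + d) by intros; ring,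
        ← Finset.sum_add_distrib]
      congr 1
      · ring
      · exact Finset.sum_congr rfl fun _ _ => by ring
    · ring
  lie_add x y z := by
    apply ext' <;> (try intro α) <;>
      simp only [bracket_def, cy_mk, cp_mk, cz_mk, cw_mk, ct_mk, cy_add, cp_add, cz_add, cw_add,
        ct_add, Pi.add_apply, Pi.zero_apply, Matrix.cons_val_zero, Matrix.cons_val_one, add_zero]
    · ring
    · ring
    · rw [show ∀ a b c d : ℝ, a - b + (c - d) = a + c - (b + d) by intros; ring,
        ← Finset.sum_add_distrib]
      congr 1
      · ring
      · exact Finset.sum_congr rfl fun _ _ => by ring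
    · rw [show ∀ a b c d : ℝ, a - b + (c - d) = a + c - (b + d) by intros; ring,
        ← Finset.sum_add_distrib]
      congr 1
      · ring
      · exact Finset.sum_congr rfl fun _ _ => by ring
    · ring
  lie_self x := by
    apply ext' <;> (try intro α) <;>
      simp [bracket_def, mul_comm]
  leibniz_lie x y z := by
    apply ext' <;> (try intro α) <;>
      simp only [bracket_def, cy_mk, cp_mk, cz_mk, cw_mk, ct_mk, cy_add, cp_add, cz_add, cw_add,
        ct_add, Pi.add_apply, Pi.zero_apply, Matrix.cons_val_zero, Matrix.cons_val_one, add_zero]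
    · ring
    · ring
    · rw [show ∀ a b c d : ℝ, a - b + (c - d) = a + c - (b + d) by intros; ring,
        ← Finset.sum_add_distrib]
      congr 1
      · ring
      · exact Finset.sum_congr rfl fun _ _ => by ring
    · rw [show ∀ a b c d : ℝ, a - b + (c - d) = a + c - (b + d) by intros; ring,
        ← Finset.sum_add_distrib]
      congr 1
      · ring
      · exact Finset.sum_congr rfl fun _ _ => by ring
    · ring

instance : LieAlgebra ℝ (TauAlg s ε r l) where
  lie_smul c x y := by
    apply ext' <;> (try intro α) <;>
      simp only [bracket_def, cy_mk, cp_mk, cz_mk, cw_mk, ct_mk, cy_smul, cp_smul, cz_smul,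
        cw_smul, ct_smul, Pi.smul_apply, smul_eq_mul, Pi.zero_apply, Matrix.cons_val_zero,
        Matrix.cons_val_one, mul_zero]
    · ring
    · ring
    · rw [mul_sub c, Finset.mul_sum]
      congr 1
      · ring
      · exact Finset.sum_congr rfl fun _ _ => by ring
    · rw [mul_sub c, Finset.mul_sum]
      congr 1
      · ring
      · exact Finset.sum_congr rfl fun _ _ => by ring
    · ring

/-- The involution: `+1` on `𝔥 = span {y, W_α*}` and `-1` on `𝔪 = span {Z_i, W_α, Z_i*}`. -/
def invol : TauAlg s ε r l →ₗ⁅ℝ⁆ TauAlg s ε r l where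
  toFun x := mk x.cy x.cp (-x.cz) (-x.cw) (-x.ct)
  map_add' x y := by
    apply ext' <;> (try intro α) <;> simp <;> ring
  map_smul' c x := by
    apply ext' <;> (try intro α) <;> simp
  map_lie' := by
    intro x y
    apply ext' <;> (try intro α) <;>
      simp only [bracket_def, cy_mk, cp_mk, cz_mk, cw_mk, ct_mk, Pi.neg_apply, Pi.zero_apply,
        Matrix.cons_val_zero, Matrix.cons_val_one, neg_zero]
    · ring
    · ring
    · rw [show ∀ a b : ℝ, -(a - b) = -a - -b by intros; ring, ← Finset.sum_neg_distrib]
      congr 1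
      · ring
      · exact Finset.sum_congr rfl fun _ _ => by ring
    · rw [show ∀ a b : ℝ, -(a - b) = -a - -b by intros; ring, ← Finset.sum_neg_distrib]
      congr 1
      · ring
      · exact Finset.sum_congr rfl fun _ _ => by ring
    · ring

/-- The bilinear form: `B(y, y) = ε`, `B(W_α*, W_β*) = δ_{αβ} ε_α`, `B(W_α, W_β) = δ_{αβ}`,
`B(Z_i, Z_j*) = δ_{ij}`, all other products of basis vectors being zero. -/
def form : LinearMap.BilinForm ℝ (TauAlg s ε r l) :=
  LinearMap.mk₂ ℝ
    (fun x x' => ((ε : ℤ) : ℝ) * (x.cy * x'.cy) + ∑ α, epsSign r α * (x.cp α * x'.cp α)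
      + ∑ i, (x.cz i * x'.ct i + x.ct i * x'.cz i) + ∑ α, x.cw α * x'.cw α)
    (by
      intro x y z
      simp only [cy_add, cp_add, cz_add, cw_add, ct_add, Pi.add_apply, add_mul, mul_add,
        Finset.sum_add_distrib]
      ring)
    (by
      intro c x y
      simp only [cy_smul, cp_smul, cz_smul, cw_smul, ct_smul, Pi.smul_apply, smul_eq_mul,
        mul_add, Finset.mul_sum, Finset.sum_add_distrib]
      simp only [mul_assoc, mul_left_comm])
    (by
      intro x y z
      simp only [cy_add, cp_add, cz_add, cw_add, ct_add, Pi.add_apply, mul_add,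
        Finset.sum_add_distrib]
      ring)
    (by
      intro c x y
      simp only [cy_smul, cp_smul, cz_smul, cw_smul, ct_smul, Pi.smul_apply, smul_eq_mul,
        mul_add, Finset.mul_sum, Finset.sum_add_distrib]
      simp only [mul_left_comm])

theorem invol_apply (x : TauAlg s ε r l) :
    invol x = mk x.cy x.cp (-x.cz) (-x.cw) (-x.ct) := rfl

theorem form_apply (x x' : TauAlg s ε r l) :
    form x x' = ((ε : ℤ) : ℝ) * (x.cy * x'.cy) + ∑ α, epsSign r α * (x.cp α * x'.cp α)
      + ∑ i, (x.cz i * x'.ct i + x.ct i * x'.cz i) + ∑ α, x.cw α * x'.cw α := rfl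

theorem form_nondegenerate (x : TauAlg s ε r l) (hx : ∀ y : TauAlg s ε r l, form x y = 0) :
    x = 0 := by
  have hε : ((ε : ℤ) : ℝ) ≠ 0 := by exact_mod_cast ε.ne_zero
  apply ext' <;> (try intro α)
  · simpa [form_apply, hε] using hx (mk 1 0 0 0 0)
  · simpa [form_apply, Pi.single_apply, epsSign_ne_zero] using hx (mk 0 (Pi.single α 1) 0 0 0)
  · simpa [form_apply] using hx (mk 0 0 0 0 ![1, 0])
  · simpa [form_apply] using hx (mk 0 0 0 0 ![0, 1])
  · simpa [form_apply, Pi.single_apply] using hx (mk 0 0 0 (Pi.single α 1) 0)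
  · simpa [form_apply] using hx (mk 0 0 ![1, 0] 0 0)
  · simpa [form_apply] using hx (mk 0 0 ![0, 1] 0 0)

theorem form_ad (x y z : TauAlg s ε r l) : form ⁅x, y⁆ z = -form y ⁅x, z⁆ := by
  simp only [form_apply, bracket_def, cy_mk, cp_mk, cz_mk, cw_mk, ct_mk, Fin.sum_univ_two,
    Pi.zero_apply, Matrix.cons_val_zero, Matrix.cons_val_one, sub_mul, mul_sub, Finset.sum_mul,
    Finset.mul_sum, zero_mul, mul_zero, zero_add, add_zero, mul_add, add_mul,
    Finset.sum_add_distrib, Finset.sum_sub_distrib]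
  simp only [mul_assoc, mul_comm, mul_left_comm]
  ring

theorem fixed_eq_span (hl : ∀ α, ∃ i, l i α ≠ 0) : {x : TauAlg s ε r l | invol x = x} =
    (Submodule.span ℝ {u | ∃ x y : TauAlg s ε r l, invol x = -x ∧ invol y = -y ∧ u = ⁅x, y⁆} :
      Set (TauAlg s ε r l)) := by
  apply Set.Subset.antisymm
  · intro x hx
    have hz : x.cz = 0 := self_eq_neg.mp (congrArg cz hx).symm
    have hw : x.cw = 0 := self_eq_neg.mp (congrArg cw hx).symm
    have ht : x.ct = 0 := self_eq_neg.mp (congrArg ct hx).symm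
    have key : x = ⁅(mk 0 0 0 0 ![x.cy, 0] : TauAlg s ε r l), mk 0 0 0 0 ![0, 1]⁆
        + (⁅(mk 0 0 0 0 ![1, 0] : TauAlg s ε r l),
            mk 0 0 0 (fun α => x.cp α * l 0 α / (l 0 α ^ 2 + l 1 α ^ 2)) 0⁆
        + ⁅(mk 0 0 0 0 ![0, 1] : TauAlg s ε r l),
            mk 0 0 0 (fun α => x.cp α * l 1 α / (l 0 α ^ 2 + l 1 α ^ 2)) 0⁆) := by
      apply ext' <;> (try intro α) <;> simp [bracket_def, hz, hw, ht]
      have h0 : l 0 α ^ 2 + l 1 α ^ 2 ≠ 0 := by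
        obtain ⟨i, hi⟩ := hl α
        fin_cases i
        · have : 0 < l 0 α ^ 2 := by positivity
          positivity
        · have : 0 < l 1 α ^ 2 := by positivity
          positivity
      field_simp
    rw [key]
    have inv : ∀ (w : Fin s → ℝ) (t : Fin 2 → ℝ),
        invol (mk 0 0 0 w t : TauAlg s ε r l) = -mk 0 0 0 w t := by
      intro w t
      apply ext' <;> simp [invol_apply]
    exact add_mem (Submodule.subset_span ⟨_, _, inv _ _, inv _ _, rfl⟩)
      (add_mem (Submodule.subset_span ⟨_, _, inv _ _, inv _ _, rfl⟩)
        (Submodule.subset_span ⟨_, _, inv _ _, inv _ _, rfl⟩))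
  · intro u hu
    induction hu using Submodule.span_induction with
    | mem u hu =>
      obtain ⟨x, y, hx, hy, rfl⟩ := hu
      change invol ⁅x, y⁆ = ⁅x, y⁆
      rw [LieHom.map_lie, hx, hy, neg_lie, lie_neg, neg_neg]
    | zero => exact map_zero _
    | add x y _ _ hx hy =>
      change invol (x + y) = x + y
      rw [map_add, show invol x = x from hx, show invol y = y from hy]
    | smul c x _ hx =>
      change invol (c • x) = c • x
      rw [map_smul, show invol x = x from hx]

end TauAlg

/-- The symmetric triple `τ_n(ε_Y, r, λ)`, `n = s + 4`, for `ε_Y = ε`, `λ_{i+1}^α = l i α`, where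
`(λ_1^α, λ_2^α) ≠ 0` for every `α`. -/
def tau (s : ℕ) (ε : ℤˣ) (r : ℕ) (l : Fin 2 → Fin s → ℝ) (hl : ∀ α, ∃ i, l i α ≠ 0) :
    SymmetricTriple where
  carrier := TauAlg s ε r l
  σ := TauAlg.invol
  B := TauAlg.form
  σ_involutive x := by
    apply TauAlg.ext' <;> simp [TauAlg.invol_apply]
  B_symm x y := by
    simp only [TauAlg.form_apply, Fin.sum_univ_two, mul_comm, add_comm]
  B_nondegenerate := TauAlg.form_nondegenerate
  B_σ x y := by simp [TauAlg.form_apply, TauAlg.invol_apply]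
  B_ad := TauAlg.form_ad
  fixed_eq_span := TauAlg.fixed_eq_span hl

/-- Isomorphism classes of the indecomposable triples `τ_n(ε_Y, r, λ)` with `(λ_1, λ_2)` of
rank `1`. -/
def RankOneClasses (n : ℕ) : Set SymmetricTriple.IsoClass :=
  {c | ∃ (ε : ℤˣ) (r : Fin (n - 4 + 1)) (l : Fin 2 → Fin (n - 4) → ℝ)
    (hl : ∀ α, ∃ i, l i α ≠ 0), (Matrix.of l).rank = 1 ∧
      (tau (n - 4) ε r l hl).Indecomposable ∧
      c = SymmetricTriple.isoClass (tau (n - 4) ε r l hl)}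

/-- The unit vectors of `ℝ^s` that lie in no coordinate hyperplane. -/
def GenericUnit (s : ℕ) : Type :=
  {v : EuclideanSpace ℝ (Fin s) // v ∈ Metric.sphere 0 1 ∧ ∀ α, v α ≠ 0}

/-- Two vectors are related if one arises from the other by a permutation `e_α ↦ e_{π α}` of the
coordinates that preserves the first `r` indices (hence also the others), together with
arbitrary sign changes of the coordinates. -/
def SignedPermRel (s r : ℕ) (v v' : GenericUnit s) : Prop :=
  ∃ (π : Equiv.Perm (Fin s)) (σ : Fin s → ℤˣ),
    (∀ α, ((π α : Fin s) : ℕ) < r ↔ (α : ℕ) < r) ∧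
    ∀ α, v'.1 (π α) = ((σ α : ℤ) : ℝ) * v.1 α

theorem signedPermRel_equivalence (s r : ℕ) : Equivalence (SignedPermRel s r) where
  refl v := ⟨1, 1, by simp, by simp⟩
  symm := by
    rintro v v' ⟨π, σ, hr, h⟩
    refine ⟨π⁻¹, fun α => σ (π⁻¹ α), fun α => ?_, fun α => ?_⟩
    · simpa using (hr (π⁻¹ α)).symm
    · have h1 := h (π⁻¹ α)
      rw [show π (π⁻¹ α) = α by simp] at h1
      rw [h1, ← mul_assoc, ← Int.cast_mul, ← Units.val_mul, Int.units_mul_self]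
      simp
  trans := by
    rintro v v' v'' ⟨π, σ, hr, h⟩ ⟨ρ, σ', hr', h'⟩
    refine ⟨ρ * π, fun α => σ' (π α) * σ α, fun α => ?_, fun α => ?_⟩
    · rw [Equiv.Perm.mul_apply, hr', hr]
    · rw [Equiv.Perm.mul_apply, h', h]
      push_cast
      ring

def signedPermSetoid (s r : ℕ) : Setoid (GenericUnit s) :=
  ⟨SignedPermRel s r, signedPermRel_equivalence s r⟩

/-- The set of orbits `[λ_1]`. -/
def SignedPermClass (s r : ℕ) : Type := Quotient (signedPermSetoid s r)

/-- The parameters `(λ_1, λ_2) = (v, 0)`. -/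
def rankOneParam {s : ℕ} (v : GenericUnit s) : Fin 2 → Fin s → ℝ := ![fun α => v.1 α, 0]

theorem rankOneParam_ne_zero {s : ℕ} (v : GenericUnit s) (α : Fin s) :
    ∃ i, rankOneParam v i α ≠ 0 := ⟨0, v.2.2 α⟩

end

/-! Indecomposability and isomorphisms of the triples `tau`. -/

/-! A base change of `(Z_1, Z_2)` in SL(2, ℝ), with the contragredient change of `(Z_1*, Z_2*)`,
fixes `y` and replaces `(λ_1, λ_2)` by the corresponding combinations. When the rank is one, this
makes `λ_2 = 0`, and a factor `diag(t, t⁻¹)` then makes `λ_1` a unit vector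
(`exists_isomorphic_rankOneParam`). Signed permutations of the `W_α` that respect the signs `ε_α`
give the remaining isomorphisms.

To separate the normal forms, let `x ∈ 𝔪` have `Z_1*`-coordinate `t`. If `λ_2 = 0`, then `(ad x)²`
is diagonal on `𝔥`: it kills `y` and has the eigenvalue `-ε_α (λ_1^α)² t²` on `W_α*`. An isomorphism
carries these eigenspaces to each other, so it determines the numbers `ε_α (λ_1^α)²` up to order and
a common positive factor. Their signs give `r`, and the unit length removes the factor. The kernel
on `𝔥` is `ℝ y`, and the sign of `B` on it is `ε_Y` (`TauAlg.eq_and_exists_perm_of_equiv`).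

Indecomposability (`TauAlg.mem_of_nondegenerate_of_invariant`) depends on whether the invariant
subspace contains a vector with nonzero `Z_1*`-coordinate: if it does, it is all of `𝔪`; if not, it
is totally isotropic. -/

/-- A vector has an orthogonal projection to a subspace on which the form is nondegenerate. -/
theorem exists_mem_forall_bilinForm_eq {E : Type*} [AddCommGroup E] [Module ℝ E]
    [FiniteDimensional ℝ E] (B : LinearMap.BilinForm ℝ E) (V : Submodule ℝ E)
    (hV : ∀ v ∈ V, (∀ w ∈ V, B v w = 0) → v = 0) (x : E) :
    ∃ v ∈ V, ∀ w ∈ V, B v w = B x w := by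
  let f : V →ₗ[ℝ] Module.Dual ℝ V := B.restrict V
  have hf : Function.Injective f := by
    refine (injective_iff_map_eq_zero f).mpr fun v hv => Subtype.ext (hV v v.2 fun w hw => ?_)
    exact LinearMap.congr_fun hv ⟨w, hw⟩
  obtain ⟨v, hv⟩ := (LinearMap.injective_iff_surjective_of_finrank_eq_finrank
    (Subspace.dual_finrank_eq).symm).mp hf ((B x).comp V.subtype)
  exact ⟨v, v.2, fun w hw => LinearMap.congr_fun hv ⟨w, hw⟩⟩

namespace SymmetricTriple

/-- A linear map of symmetric triples of equal dimension that respects all the structure is an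
isomorphism; injectivity is automatic because it is isometric. -/
theorem isomorphic_of_linearMap {τ₁ τ₂ : SymmetricTriple} (f : τ₁.carrier →ₗ[ℝ] τ₂.carrier)
    (hdim : Module.finrank ℝ τ₁.carrier = Module.finrank ℝ τ₂.carrier)
    (hlie : ∀ x y, f ⁅x, y⁆ = ⁅f x, f y⁆) (hσ : ∀ x, f (τ₁.σ x) = τ₂.σ (f x))
    (hB : ∀ x y, τ₁.B x y = τ₂.B (f x) (f y)) : Isomorphic τ₁ τ₂ := by
  have hf : Function.Injective f := by
    refine (injective_iff_map_eq_zero f).mpr fun x hx => τ₁.B_nondegenerate x fun y => ?_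
    rw [hB, hx, map_zero, LinearMap.zero_apply]
  refine ⟨{ LinearMap.linearEquivOfInjective f hf hdim with map_lie' := ?_ }, hσ, hB⟩
  intro x y
  exact hlie x y

end SymmetricTriple

namespace TauAlg

variable {s : ℕ} {ε : ℤˣ} {r : ℕ} {l : Fin 2 → Fin s → ℝ}

/-! ### Eigenspaces of the involution and the action of `𝔥`. -/

theorem units_cast_ne_zero (ε : ℤˣ) : ((ε : ℤ) : ℝ) ≠ 0 := by exact_mod_cast ε.ne_zero

theorem invol_eq_neg_iff {x : TauAlg s ε r l} : invol x = -x ↔ x.cy = 0 ∧ x.cp = 0 := by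
  constructor
  · intro hx
    exact ⟨self_eq_neg.mp (congrArg cy hx), self_eq_neg.mp (congrArg cp hx)⟩
  · rintro ⟨h1, h2⟩
    apply ext' <;> (try intro α) <;> simp [invol_apply, h1, h2]

theorem invol_eq_self_iff {x : TauAlg s ε r l} :
    invol x = x ↔ x.cz = 0 ∧ x.cw = 0 ∧ x.ct = 0 := by
  constructor
  · intro hx
    exact ⟨self_eq_neg.mp (congrArg cz hx).symm, self_eq_neg.mp (congrArg cw hx).symm,
      self_eq_neg.mp (congrArg ct hx).symm⟩
  · rintro ⟨h1, h2, h3⟩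
    apply ext' <;> (try intro α) <;> simp [invol_apply, h1, h2, h3]

theorem y_lie (x : TauAlg s ε r l) : ⁅(mk 1 0 0 0 0 : TauAlg s ε r l), x⁆ =
    mk 0 0 ![-((ε : ℤ) : ℝ) * x.ct 1, ((ε : ℤ) : ℝ) * x.ct 0] 0 0 := by
  apply ext' <;> (try intro α) <;> simp [bracket_def]

/-- Up to nonzero factors (for `l 0 β ≠ 0`), `ad W_β*` acts on `𝔪` by the chain `Z_1* → W_β → Z_1 →
0`. Together with `Z_1* → Z_2` and `Z_2* → Z_1` under `ad y`, this is all that indecomposability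
uses. -/
theorem Wstar_lie (h1 : l 1 = 0) (β : Fin s) (x : TauAlg s ε r l) :
    ⁅(mk 0 (Pi.single β 1) 0 0 0 : TauAlg s ε r l), x⁆ =
      mk 0 0 ![-(epsSign r β * l 0 β * x.cw β), 0]
        (Pi.single β (epsSign r β * l 0 β * x.ct 0)) 0 := by
  apply ext' <;> (try intro α)
  · simp [bracket_def]
  · simp [bracket_def]
  · simp [bracket_def, Pi.single_apply]
  · simp [bracket_def, h1]
  · by_cases h : α = β
    · subst h; simp [bracket_def, h1, mul_assoc]
    · simp [bracket_def, h]
  · simp [bracket_def]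
  · simp [bracket_def]

/-! ### Indecomposability for `λ_2 = 0`. -/

/-- An `ad 𝔥`-invariant subspace that has a vector with nonzero `Z_1*`-coordinate contains the
span of the `Z_i` and `W_α`. -/
theorem mem_of_ct_zero_ne_zero (h0 : ∀ α, l 0 α ≠ 0) (h1 : l 1 = 0) (hs : 0 < s)
    (V : Submodule ℝ (TauAlg s ε r l))
    (hV : ∀ x : TauAlg s ε r l, invol x = x → ∀ v ∈ V, ⁅x, v⁆ ∈ V)
    {x : TauAlg s ε r l} (hx : x ∈ V) (hx0 : x.ct 0 ≠ 0) (z : Fin 2 → ℝ) (w : Fin s → ℝ) :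
    (mk 0 0 z w 0 : TauAlg s ε r l) ∈ V := by
  have hp : ∀ p : Fin s → ℝ, invol (mk 0 p 0 0 0 : TauAlg s ε r l) = mk 0 p 0 0 0 := fun p => by
    rw [invol_eq_self_iff]; simp
  have hy : invol (mk 1 0 0 0 0 : TauAlg s ε r l) = mk 1 0 0 0 0 := by
    rw [invol_eq_self_iff]; simp
  have hZ1 : ∀ c : ℝ, (mk 0 0 ![c, 0] 0 0 : TauAlg s ε r l) ∈ V := by
    intro c
    -- Any index serves: `(ad W_β*)²` sends `x` to a nonzero multiple of `Z_1`.
    let β : Fin s := ⟨0, hs⟩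
    have h := hV _ (hp (Pi.single β 1)) _ (hV _ (hp (Pi.single β 1)) x hx)
    rw [Wstar_lie h1, Wstar_lie h1] at h
    have hne : epsSign r β * l 0 β * (epsSign r β * l 0 β * x.ct 0) ≠ 0 :=
      mul_ne_zero (mul_ne_zero (epsSign_ne_zero _ _) (h0 _))
        (mul_ne_zero (mul_ne_zero (epsSign_ne_zero _ _) (h0 _)) hx0)
    convert V.smul_mem (-c / (epsSign r β * l 0 β * (epsSign r β * l 0 β * x.ct 0))) h using 1
    apply ext' <;> (try intro α) <;> simp
    rw [neg_div, neg_mul, neg_neg, div_mul_cancel₀ _ hne]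
  have hZ2 : ∀ c : ℝ, (mk 0 0 ![0, c] 0 0 : TauAlg s ε r l) ∈ V := by
    intro c
    have h := hV _ hy x hx
    rw [y_lie] at h
    have hne := mul_ne_zero (units_cast_ne_zero ε) hx0
    -- The `Z_1`-component of `[y, x]` is cancelled by a vector already in `V`.
    convert V.smul_mem (c / (((ε : ℤ) : ℝ) * x.ct 0))
      (V.add_mem h (hZ1 (((ε : ℤ) : ℝ) * x.ct 1))) using 1
    apply ext' <;> (try intro α) <;> simp
    rw [div_mul_cancel₀ _ hne]
  have hW : ∀ (β : Fin s) (c : ℝ), (mk 0 0 0 (Pi.single β c) 0 : TauAlg s ε r l) ∈ V := by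
    intro β c
    have h := hV _ (hp (Pi.single β 1)) x hx
    rw [Wstar_lie h1] at h
    have hne : epsSign r β * l 0 β * x.ct 0 ≠ 0 :=
      mul_ne_zero (mul_ne_zero (epsSign_ne_zero _ _) (h0 _)) hx0
    convert V.smul_mem (c / (epsSign r β * l 0 β * x.ct 0))
      (V.add_mem h (hZ1 (epsSign r β * l 0 β * x.cw β))) using 1
    apply ext' <;> (try intro α) <;> simp
    by_cases hα : α = β
    · subst hα; simp [div_mul_cancel₀ _ hne]
    · simp [hα]
  have hsum : (mk 0 0 z w 0 : TauAlg s ε r l) = mk 0 0 ![z 0, 0] 0 0 + mk 0 0 ![0, z 1] 0 0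
      + ∑ β, mk 0 0 0 (Pi.single β (w β)) 0 := by
    let L : (Fin s → ℝ) →ₗ[ℝ] TauAlg s ε r l :=
      { toFun := fun w => mk 0 0 0 w 0
        map_add' := fun w w' => by apply ext' <;> simp
        map_smul' := fun c w => by apply ext' <;> simp }
    have hL : ∑ β, (mk 0 0 0 (Pi.single β (w β)) 0 : TauAlg s ε r l) = mk 0 0 0 w 0 := by
      change ∑ β, L (Pi.single β (w β)) = L w
      rw [← map_sum, Finset.univ_sum_single]
    rw [hL]
    apply ext' <;> simp
  rw [hsum]
  exact V.add_mem (V.add_mem (hZ1 _) (hZ2 _)) (V.sum_mem fun β _ => hW β _)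

/-- If `λ_2 = 0` and all coordinates of `λ_1` are nonzero, then a nonzero nondegenerate
`ad 𝔥`-invariant subspace of `𝔪` is equal to `𝔪`. -/
theorem mem_of_nondegenerate_of_invariant (h0 : ∀ α, l 0 α ≠ 0) (h1 : l 1 = 0) (hs : 0 < s)
    {V : Submodule ℝ (TauAlg s ε r l)} (hVm : ∀ x ∈ V, invol x = -x) (hV0 : V ≠ ⊥)
    (hnd : ∀ v ∈ V, (∀ w ∈ V, form v w = 0) → v = 0)
    (hinv : ∀ x : TauAlg s ε r l, invol x = x → ∀ v ∈ V, ⁅x, v⁆ ∈ V)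
    {u : TauAlg s ε r l} (hu : invol u = -u) : u ∈ V := by
  have hm : ∀ x ∈ V, x.cy = 0 ∧ x.cp = 0 := fun x hx => invol_eq_neg_iff.mp (hVm x hx)
  by_cases hex : ∃ x ∈ V, x.ct 0 ≠ 0
  · obtain ⟨x, hx, hx0⟩ := hex
    have hmem := mem_of_ct_zero_ne_zero h0 h1 hs V hinv hx hx0
    obtain ⟨v, hv, hvu⟩ := exists_mem_forall_bilinForm_eq form V hnd u
    have hu' := invol_eq_neg_iff.mp hu
    have hv' := hm v hv
    have key : ∀ z w, form v (mk 0 0 z w 0) = form u (mk 0 0 z w 0) := fun z w =>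
      hvu _ (hmem z w)
    have hct : ∀ i, v.ct i = u.ct i := fun i => by
      simpa [form_apply, Pi.single_apply] using key (Pi.single i 1) 0
    have hcw : ∀ α, v.cw α = u.cw α := fun α => by
      simpa [form_apply, Pi.single_apply] using key 0 (Pi.single α 1)
    -- Since `V` contains all `Z_i` and `W_α`, the projection `v` of `u` can differ from `u` only in
    -- the span of the `Z_i`, which lies in `V`.
    have hsum : u = v + mk 0 0 (u.cz + -v.cz) 0 0 := by
      apply ext' <;> (try intro α) <;> simp [hu', hv', hct, hcw]
    rw [hsum]
    exact V.add_mem hv (hmem _ _)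
  · push Not at hex
    -- `Z_1` pairs only with `Z_1*`, so it would lie in the radical of `V`. Hence any element of `𝔥`
    -- that maps a vector of `V` to a multiple of `Z_1` must map it to zero.
    have hZ1 : ∀ c : ℝ, c ≠ 0 → (mk 0 0 ![c, 0] 0 0 : TauAlg s ε r l) ∉ V := by
      intro c hc h
      have h0 := hnd _ h fun w hw => by simp [form_apply, hex w hw]
      exact hc (congrFun (congrArg cz h0) 0)
    have hct : ∀ x ∈ V, x.ct 1 = 0 := by
      intro x hx
      by_contra hne
      have h := hinv (mk 1 0 0 0 0) (invol_eq_self_iff.mpr ⟨rfl, rfl, rfl⟩) x hx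
      rw [y_lie, hex x hx, mul_zero] at h
      exact hZ1 _ (mul_ne_zero (neg_ne_zero.mpr (units_cast_ne_zero ε)) hne) h
    have hcw : ∀ x ∈ V, ∀ α, x.cw α = 0 := by
      intro x hx α
      by_contra hne
      have h := hinv (mk 0 (Pi.single α 1) 0 0 0) (invol_eq_self_iff.mpr ⟨rfl, rfl, rfl⟩) x hx
      rw [Wstar_lie h1, hex x hx, mul_zero, Pi.single_zero] at h
      exact hZ1 _ (neg_ne_zero.mpr
        (mul_ne_zero (mul_ne_zero (epsSign_ne_zero r α) (h0 α)) hne)) h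
    -- What remains of `V` lies in the totally isotropic span of the `Z_i`.
    refine absurd ((Submodule.eq_bot_iff V).mpr fun x hx => hnd x hx fun w hw => ?_) hV0
    simp [form_apply, hm x hx, hex x hx, hct x hx, hcw x hx, hex w hw, hct w hw]

theorem indecomposable_of_zero (h0 : ∀ α, l 0 α ≠ 0) (h1 : l 1 = 0) (hs : 0 < s)
    (hl : ∀ α, ∃ i, l i α ≠ 0) : (tau s ε r l hl).Indecomposable := by
  rintro ⟨V, hVm, hV0, hVne, hnd, hinv⟩
  exact hVne (le_antisymm hVm fun u hu =>
    mem_of_nondegenerate_of_invariant h0 h1 hs hVm hV0 hnd hinv hu)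

/-! ### Isomorphisms between triples with different `λ`. -/

/-- A linear map of the underlying vector spaces that respects brackets, involutions and forms
is an isomorphism of the triples. -/
theorem isomorphic_of_linearMap {r' : ℕ} {ε' : ℤˣ} {l' : Fin 2 → Fin s → ℝ}
    (hl : ∀ α, ∃ i, l i α ≠ 0)
    (hl' : ∀ α, ∃ i, l' i α ≠ 0) (f : TauAlg s ε r l →ₗ[ℝ] TauAlg s ε' r' l')
    (hlie : ∀ x y, f ⁅x, y⁆ = ⁅f x, f y⁆) (hσ : ∀ x, f (invol x) = invol (f x))
    (hB : ∀ x y, form x y = form (f x) (f y)) :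
    (tau s ε r l hl).Isomorphic (tau s ε' r' l' hl') :=
  SymmetricTriple.isomorphic_of_linearMap (τ₁ := tau s ε r l hl) (τ₂ := tau s ε' r' l' hl')
    f rfl hlie hσ hB

/-- A base change in `SL(2, ℝ)` of the pair `(λ_1, λ_2)` does not change the isomorphism class. -/
theorem isomorphic_of_det_eq_one {l' : Fin 2 → Fin s → ℝ} (hl : ∀ α, ∃ i, l i α ≠ 0)
    (hl' : ∀ α, ∃ i, l' i α ≠ 0) (a b c d : ℝ) (hdet : a * d - b * c = 1)
    (h0 : ∀ α, l' 0 α = a * l 0 α + b * l 1 α) (h1 : ∀ α, l' 1 α = c * l 0 α + d * l 1 α) :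
    (tau s ε r l hl).Isomorphic (tau s ε r l' hl') := by
  -- The `Z_i*`-coordinates change by the inverse transpose of the matrix on the `Z_i`-coordinates,
  -- which preserves their pairing. As the determinant is `1`, the relation `[Z_1*, Z_2*] = y`
  -- survives with `y` fixed.
  let f : TauAlg s ε r l →ₗ[ℝ] TauAlg s ε r l' :=
    { toFun := fun x => mk x.cy x.cp ![a * x.cz 0 + b * x.cz 1, c * x.cz 0 + d * x.cz 1] x.cw
        ![d * x.ct 0 - c * x.ct 1, a * x.ct 1 - b * x.ct 0]
      map_add' := fun x y => by apply ext' <;> (try intro α) <;> simp <;> ring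
      map_smul' := fun k x => by apply ext' <;> (try intro α) <;> simp <;> ring }
  have hf : ∀ x, f x = mk x.cy x.cp ![a * x.cz 0 + b * x.cz 1, c * x.cz 0 + d * x.cz 1] x.cw
        ![d * x.ct 0 - c * x.ct 1, a * x.ct 1 - b * x.ct 0] := fun _ => rfl
  refine isomorphic_of_linearMap hl hl' f (fun x y => ?_) (fun x => ?_)
    fun x y => ?_
  · apply ext' <;> (try intro α) <;>
      simp only [hf, bracket_def, cy_mk, cp_mk, cz_mk, cw_mk, ct_mk, Pi.zero_apply,
        Matrix.cons_val_zero, Matrix.cons_val_one, h0, h1]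
    · linear_combination -(ct x 0 * ct y 1 - ct x 1 * ct y 0) * hdet
    · linear_combination -(l 0 α * (ct x 0 * cw y α - ct y 0 * cw x α)
        + l 1 α * (ct x 1 * cw y α - ct y 1 * cw x α)) * hdet
    · have e : ∑ α, epsSign r α * (a * l 0 α + b * l 1 α) *
          (cp x α * cw y α - cp y α * cw x α) =
          a * ∑ α, epsSign r α * l 0 α * (cp x α * cw y α - cp y α * cw x α)
          + b * ∑ α, epsSign r α * l 1 α * (cp x α * cw y α - cp y α * cw x α) := by
        rw [Finset.mul_sum, Finset.mul_sum, ← Finset.sum_add_distrib]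
        exact Finset.sum_congr rfl fun _ _ => by ring
      rw [e]; ring
    · have e : ∑ α, epsSign r α * (c * l 0 α + d * l 1 α) *
          (cp x α * cw y α - cp y α * cw x α) =
          c * ∑ α, epsSign r α * l 0 α * (cp x α * cw y α - cp y α * cw x α)
          + d * ∑ α, epsSign r α * l 1 α * (cp x α * cw y α - cp y α * cw x α) := by
        rw [Finset.mul_sum, Finset.mul_sum, ← Finset.sum_add_distrib]
        exact Finset.sum_congr rfl fun _ _ => by ring
      rw [e]; ring
    · linear_combination -epsSign r α * (l 0 α * (cp x α * ct y 0 - cp y α * ct x 0)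
        + l 1 α * (cp x α * ct y 1 - cp y α * ct x 1)) * hdet
    · ring
    · ring
  · apply ext' <;> (try intro α) <;> simp [hf, invol_apply] <;> ring
  · simp only [hf, form_apply, cy_mk, cp_mk, cz_mk, cw_mk, ct_mk, Fin.sum_univ_two,
        Matrix.cons_val_zero, Matrix.cons_val_one]
    linear_combination -(cz x 0 * ct y 0 + ct x 0 * cz y 0 + (cz x 1 * ct y 1 + ct x 1 * cz y 1))
      * hdet

theorem units_cast_mul_self (u : ℤˣ) : ((u : ℤ) : ℝ) * ((u : ℤ) : ℝ) = 1 := by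
  rw [← Int.cast_mul, ← Units.val_mul, Int.units_mul_self]; simp

theorem epsSign_perm {π : Equiv.Perm (Fin s)}
    (hr : ∀ α, ((π α : Fin s) : ℕ) < r ↔ (α : ℕ) < r) (α : Fin s) :
    epsSign r (π α) = epsSign r α := by
  simp only [epsSign, hr]

/-- Signed permutations of the indices that preserve the partition do not change the isomorphism
class. -/
theorem isomorphic_of_signed_perm {l' : Fin 2 → Fin s → ℝ} (hl : ∀ α, ∃ i, l i α ≠ 0)
    (hl' : ∀ α, ∃ i, l' i α ≠ 0) (π : Equiv.Perm (Fin s)) (u : Fin s → ℤˣ)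
    (hr : ∀ α, ((π α : Fin s) : ℕ) < r ↔ (α : ℕ) < r)
    (h : ∀ i α, l' i (π α) = ((u α : ℤ) : ℝ) * l i α) :
    (tau s ε r l hl).Isomorphic (tau s ε r l' hl') := by
  -- The sign is put on `W_α` but not on `W_α*`, so that it reverses `λ_i^α`.
  let f : TauAlg s ε r l →ₗ[ℝ] TauAlg s ε r l' :=
    { toFun := fun x => mk x.cy (fun α => x.cp (π.symm α)) x.cz
        (fun α => ((u (π.symm α) : ℤ) : ℝ) * x.cw (π.symm α)) x.ct
      map_add' := fun x y => by apply ext' <;> (try intro α) <;> simp <;> ring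
      map_smul' := fun k x => by apply ext' <;> (try intro α) <;> simp <;> ring }
  have hf : ∀ x, f x = mk x.cy (fun α => x.cp (π.symm α)) x.cz
        (fun α => ((u (π.symm α) : ℤ) : ℝ) * x.cw (π.symm α)) x.ct := fun _ => rfl
  have hsum : ∀ (i : Fin 2) (x y : TauAlg s ε r l),
      ∑ α, epsSign r α * l' i α * ((f x).cp α * (f y).cw α - (f y).cp α * (f x).cw α) =
      ∑ α, epsSign r α * l i α * (x.cp α * y.cw α - y.cp α * x.cw α) := by
    intro i x y
    rw [← Equiv.sum_comp π]
    refine Finset.sum_congr rfl fun α _ => ?_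
    simp only [hf, cp_mk, cw_mk, Equiv.symm_apply_apply, epsSign_perm hr, h]
    linear_combination epsSign r α * l i α * (x.cp α * y.cw α - y.cp α * x.cw α)
      * units_cast_mul_self (u α)
  refine isomorphic_of_linearMap hl hl' f (fun x y => ?_) (fun x => ?_)
    fun x y => ?_
  · rw [bracket_def (f x)]
    apply ext'
    · simp [hf, bracket_def]
    · intro α
      obtain ⟨β, rfl⟩ := π.surjective α
      simp only [hf, bracket_def, cp_mk, cw_mk, ct_mk, Equiv.symm_apply_apply, h]
      linear_combination -(l 0 β * (ct x 0 * cw y β - ct y 0 * cw x β)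
        + l 1 β * (ct x 1 * cw y β - ct y 1 * cw x β)) * units_cast_mul_self (u β)
    · simp only [cz_mk, Matrix.cons_val_zero, hsum]
      simp [hf, bracket_def]
    · simp only [cz_mk, Matrix.cons_val_one, hsum]
      simp [hf, bracket_def]
    · intro α
      obtain ⟨β, rfl⟩ := π.surjective α
      simp only [hf, bracket_def, cp_mk, cw_mk, ct_mk, Equiv.symm_apply_apply, h,
        epsSign_perm hr]
      ring
    · simp [hf, bracket_def]
    · simp [hf, bracket_def]
  · apply ext' <;> (try intro α) <;> simp [hf, invol_apply]
  · rw [form_apply, form_apply,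
      ← Equiv.sum_comp π (fun α => epsSign r α * ((f x).cp α * (f y).cp α)),
      ← Equiv.sum_comp π (fun α => (f x).cw α * (f y).cw α)]
    simp only [hf, cy_mk, cp_mk, cz_mk, cw_mk, ct_mk, Equiv.symm_apply_apply, epsSign_perm hr]
    congr 1
    refine Finset.sum_congr rfl fun α _ => ?_
    linear_combination -(cw x α * cw y α) * units_cast_mul_self (u α)

end TauAlg

/-! Invariants of the triples `tau` and the classification. -/

namespace TauAlg

section invariants

variable {s : ℕ} {ε ε' : ℤˣ} {r r' : ℕ} {l l' : Fin 2 → Fin s → ℝ}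

/-! ### The spectrum of `(ad x)²` on `𝔥` as an invariant. -/

/-- If `λ_2 = 0`, then for `x ∈ 𝔪` the operator `(ad x)²` is diagonal on `𝔥`. -/
theorem lie_lie_of_mem (h1 : l 1 = 0) {x u : TauAlg s ε r l} (hx : invol x = -x)
    (hu : invol u = u) :
    ⁅x, ⁅x, u⁆⁆ = mk 0 (fun α => -(epsSign r α * l 0 α ^ 2 * x.ct 0 ^ 2) * u.cp α) 0 0 0 := by
  obtain ⟨hxy, hxp⟩ := invol_eq_neg_iff.mp hx
  obtain ⟨huz, huw, hut⟩ := invol_eq_self_iff.mp hu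
  apply ext' <;> (try intro α) <;> simp [bracket_def, h1, hxy, hxp, huw, hut]
  ring

/-- The intersection of `𝔥` with the eigenspace of `(ad x)²` for the value `μ`. -/
def fixedEigenspace (x : TauAlg s ε r l) (μ : ℝ) : Submodule ℝ (TauAlg s ε r l) where
  carrier := {u | invol u = u ∧ ⁅x, ⁅x, u⁆⁆ = μ • u}
  add_mem' := by
    rintro u v ⟨hu, hu'⟩ ⟨hv, hv'⟩
    exact ⟨by rw [map_add, hu, hv], by rw [lie_add, lie_add, hu', hv', smul_add]⟩
  zero_mem' := by simp
  smul_mem' := by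
    rintro c u ⟨hu, hu'⟩
    exact ⟨by rw [map_smul, hu], by rw [lie_smul, lie_smul, hu', smul_comm]⟩

theorem mem_fixedEigenspace {x : TauAlg s ε r l} {μ : ℝ} {u : TauAlg s ε r l} :
    u ∈ fixedEigenspace x μ ↔ invol u = u ∧ ⁅x, ⁅x, u⁆⁆ = μ • u := Iff.rfl

theorem mem_fixedEigenspace_iff (h1 : l 1 = 0) {x : TauAlg s ε r l} (hx : invol x = -x) {μ : ℝ}
    {u : TauAlg s ε r l} : u ∈ fixedEigenspace x μ ↔ invol u = u ∧ μ * u.cy = 0 ∧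
      ∀ α, -(epsSign r α * l 0 α ^ 2 * x.ct 0 ^ 2) * u.cp α = μ * u.cp α := by
  rw [mem_fixedEigenspace]
  refine and_congr_right fun hu => ?_
  rw [lie_lie_of_mem h1 hx hu]
  constructor
  · intro h
    exact ⟨(congrArg cy h).symm, fun α => congrFun (congrArg cp h) α⟩
  · rintro ⟨h2, h3⟩
    obtain ⟨huz, huw, hut⟩ := invol_eq_self_iff.mp hu
    apply ext' <;> (try intro α) <;> simp only [cy_mk, cp_mk, cz_mk, cw_mk, ct_mk, cy_smul,
      cp_smul, cz_smul, cw_smul, ct_smul, huz, huw, hut, h2, h3, Pi.smul_apply,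
      smul_eq_mul, Pi.zero_apply, mul_zero]

/-- The vectors `y` and `W_α*` diagonalize the operator on `𝔥`. Since `y` has eigenvalue `0`, the
condition `μ ≠ 0` leaves exactly the `W_α*` with matching eigenvalue. -/
theorem finrank_fixedEigenspace (h1 : l 1 = 0) {x : TauAlg s ε r l} (hx : invol x = -x) {μ : ℝ}
    (hμ : μ ≠ 0) : Module.finrank ℝ (fixedEigenspace x μ) =
      Fintype.card {α // -(epsSign r α * l 0 α ^ 2 * x.ct 0 ^ 2) = μ} := by
  classical
  let f : fixedEigenspace x μ →ₗ[ℝ]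
      ({α // -(epsSign r α * l 0 α ^ 2 * x.ct 0 ^ 2) = μ} → ℝ) :=
    { toFun := fun u α => cp u.1 α
      map_add' := fun _ _ => rfl
      map_smul' := fun _ _ => rfl }
  have hf : Function.Bijective f := by
    constructor
    · refine (injective_iff_map_eq_zero f).mpr fun u hu => Subtype.ext ?_
      obtain ⟨h2, h3, h4⟩ := (mem_fixedEigenspace_iff h1 hx).mp u.2
      obtain ⟨huz, huw, hut⟩ := invol_eq_self_iff.mp h2
      apply ext' <;> (try intro α) <;> simp only [huz, huw, hut, ZeroMemClass.coe_zero, cy_zero,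
        cp_zero, cz_zero, cw_zero, ct_zero]
      · exact (mul_eq_zero.mp h3).resolve_left hμ
      · by_cases hα : -(epsSign r α * l 0 α ^ 2 * x.ct 0 ^ 2) = μ
        · exact congrFun hu ⟨α, hα⟩
        · by_contra hne
          exact hα (mul_right_cancel₀ hne (h4 α))
    · intro g
      refine ⟨⟨mk 0 (fun α => if hα : -(epsSign r α * l 0 α ^ 2 * x.ct 0 ^ 2) = μ
        then g ⟨α, hα⟩ else 0) 0 0 0, (mem_fixedEigenspace_iff h1 hx).mpr ⟨?_, ?_, ?_⟩⟩, ?_⟩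
      · rw [invol_eq_self_iff]; simp
      · simp
      · intro α
        by_cases hα : -(epsSign r α * l 0 α ^ 2 * x.ct 0 ^ 2) = μ <;> simp [hα]
      · funext α
        exact dif_pos α.2
  rw [(LinearEquiv.ofBijective f hf).finrank_eq, Module.finrank_fintype_fun_eq_card]

/-- The eigenspace is defined by the bracket and the involution alone, so its dimension can be
compared across an isomorphism. -/
theorem map_fixedEigenspace (Φ : TauAlg s ε r l ≃ₗ⁅ℝ⁆ TauAlg s ε' r' l')
    (hΦ : ∀ x, Φ (invol x) = invol (Φ x)) (x : TauAlg s ε r l) (μ : ℝ) :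
    (fixedEigenspace x μ).map (Φ.toLinearEquiv : TauAlg s ε r l →ₗ[ℝ] TauAlg s ε' r' l') =
      fixedEigenspace (Φ x) μ := by
  ext u
  obtain ⟨u, rfl⟩ : ∃ w, Φ w = u := Φ.surjective u
  constructor
  · rintro ⟨v, ⟨hv, hv'⟩, hvu⟩
    obtain rfl : v = u := Φ.injective hvu
    exact ⟨by rw [← hΦ, hv], by rw [← LieEquiv.map_lie, ← LieEquiv.map_lie, hv', map_smul]⟩
  · rintro ⟨hv, hv'⟩
    have hinj : ∀ {v w}, Φ v = Φ w → v = w := fun h => Φ.injective h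
    refine ⟨u, ⟨hinj (by rw [hΦ, hv]), hinj ?_⟩, rfl⟩
    rw [LieEquiv.map_lie, LieEquiv.map_lie, hv', map_smul]

/-- The invariants of an isomorphism: the sign `ε_Y`, and the numbers `ε_α (λ_1^α)²` up to order
and a common positive factor. -/
theorem eq_and_exists_perm_of_equiv (h0 : ∀ α, l 0 α ≠ 0) (h1 : l 1 = 0)
    (h0' : ∀ α, l' 0 α ≠ 0) (h1' : l' 1 = 0) (hs : 0 < s)
    (Φ : TauAlg s ε r l ≃ₗ⁅ℝ⁆ TauAlg s ε' r' l') (hΦ : ∀ x, Φ (invol x) = invol (Φ x))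
    (hB : ∀ x y, form x y = form (Φ x) (Φ y)) :
    ε = ε' ∧ ∃ a : ℝ, a ≠ 0 ∧ ∃ π : Equiv.Perm (Fin s), ∀ α,
      epsSign r' (π α) * l' 0 (π α) ^ 2 * a ^ 2 = epsSign r α * l 0 α ^ 2 := by
  classical
  let x : TauAlg s ε r l := mk 0 0 0 0 ![1, 0]
  have hx : invol x = -x := invol_eq_neg_iff.mpr ⟨rfl, rfl⟩
  have hx' : invol (Φ x) = -Φ x := by rw [← hΦ, hx, map_neg]
  have hxt : x.ct 0 = 1 := rfl
  have hcard : ∀ μ : ℝ, μ ≠ 0 →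
      Fintype.card {α // -(epsSign r α * l 0 α ^ 2 * x.ct 0 ^ 2) = μ} =
      Fintype.card {α // -(epsSign r' α * l' 0 α ^ 2 * (Φ x).ct 0 ^ 2) = μ} := by
    intro μ hμ
    rw [← finrank_fixedEigenspace h1 hx hμ, ← finrank_fixedEigenspace h1' hx' hμ,
      ← map_fixedEigenspace Φ hΦ, LinearEquiv.finrank_map_eq]
  have hne : ∀ α, -(epsSign r α * l 0 α ^ 2 * x.ct 0 ^ 2) ≠ 0 := fun α => by
    simp [hxt, epsSign_ne_zero, h0]
  -- Otherwise `(ad (Φ x))²` would vanish on `𝔥`, whereas `(ad x)²` has a nonzero eigenvalue because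
  -- `0 < s`.
  have ha : (Φ x).ct 0 ≠ 0 := by
    intro ha
    refine (Fintype.card_pos_iff.mpr ⟨⟨⟨0, hs⟩, rfl⟩⟩).ne'
      ((hcard _ (hne ⟨0, hs⟩)).trans (Fintype.card_eq_zero_iff.mpr ⟨fun α => ?_⟩))
    refine hne ⟨0, hs⟩ (α.2.symm.trans ?_)
    simp [ha]
  have hne' : ∀ α, -(epsSign r' α * l' 0 α ^ 2 * (Φ x).ct 0 ^ 2) ≠ 0 := fun α => by
    simp [ha, epsSign_ne_zero, h0']
  constructor
  · let y : TauAlg s ε r l := mk 1 0 0 0 0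
    have hy : y ∈ fixedEigenspace x 0 := (mem_fixedEigenspace_iff h1 hx).mpr
      ⟨invol_eq_self_iff.mpr ⟨rfl, rfl, rfl⟩, by simp, fun α => by simp [y]⟩
    have hy' : Φ y ∈ fixedEigenspace (Φ x) 0 := by
      rw [← map_fixedEigenspace Φ hΦ]
      exact ⟨y, hy, rfl⟩
    obtain ⟨h2, -, h4⟩ := (mem_fixedEigenspace_iff h1' hx').mp hy'
    obtain ⟨huz, huw, hut⟩ := invol_eq_self_iff.mp h2
    -- The kernel of `(ad (Φ x))²` on `𝔥` is the line through `y`, so `Φ y` is a multiple of `y`.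
    have hp : (Φ y).cp = 0 := funext fun α => by
      have := h4 α
      rw [zero_mul] at this
      exact (mul_eq_zero.mp this).resolve_left (hne' α)
    -- This becomes `ε = ε' c²`, with `c` the `y`-coordinate of `Φ y`, and forces equal signs.
    have h := hB y y
    simp only [form_apply, huz, huw, hut, hp] at h
    simp [y] at h
    rcases Int.units_eq_one_or ε with rfl | rfl <;> rcases Int.units_eq_one_or ε' with rfl | rfl
    · rfl
    · simp at h; nlinarith [mul_self_nonneg (Φ (mk 1 0 0 0 0)).cy]
    · simp at h; nlinarith [mul_self_nonneg (Φ (mk 1 0 0 0 0)).cy]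
    · rfl
  · have e : ∀ μ, Nonempty ({α // -(epsSign r α * l 0 α ^ 2 * x.ct 0 ^ 2) = μ} ≃
        {α // -(epsSign r' α * l' 0 α ^ 2 * (Φ x).ct 0 ^ 2) = μ}) := by
      intro μ
      -- The dimension count does not cover `μ = 0`, but there both fibres are empty.
      by_cases hμ : μ = 0
      · subst hμ
        have := Subtype.isEmpty_of_false hne
        have := Subtype.isEmpty_of_false hne'
        exact ⟨Equiv.equivOfIsEmpty _ _⟩
      · exact Fintype.card_eq.mp (hcard μ hμ)
    -- Bijections between the fibres of the two eigenvalue functions assemble to a permutation of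
    -- the indices.
    refine ⟨_, ha, Equiv.ofFiberEquiv fun μ => (e μ).some, fun α => ?_⟩
    have h := neg_injective (Equiv.ofFiberEquiv_map (fun μ => (e μ).some) α)
    exact h.trans (by rw [hxt, one_pow, mul_one])

end invariants

end TauAlg

/-! ### Unit vectors as normal forms. -/

theorem sum_sq_eq_one {s : ℕ} (v : GenericUnit s) : ∑ α, v.1 α ^ 2 = 1 := by
  have h := mem_sphere_zero_iff_norm.mp v.2.1
  rw [← EuclideanSpace.real_norm_sq_eq, h, one_pow]

theorem GenericUnit.pos {s : ℕ} (v : GenericUnit s) : 0 < s := by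
  rcases Nat.eq_zero_or_pos s with rfl | h
  · simpa using sum_sq_eq_one v
  · exact h

theorem epsSign_neg_iff {r s : ℕ} {α : Fin s} : epsSign r α < 0 ↔ (α : ℕ) < r := by
  unfold epsSign; split_ifs with h <;> simp [h]

theorem card_lt_val {s r : ℕ} (hr : r ≤ s) : Fintype.card {α : Fin s // (α : ℕ) < r} = r := by
  rw [Fintype.card_subtype]
  rw [Fin.card_filter_val_lt, min_eq_right hr]

/-- Isomorphic triples with parameters `(λ_1, 0)`, `λ_1` a unit vector, have the same parameters
up to signed permutations. -/
theorem signedPermRel_of_isomorphic {s : ℕ} {ε ε' : ℤˣ} {r r' : ℕ} (hr : r ≤ s) (hr' : r' ≤ s)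
    {v v' : GenericUnit s}
    (h : (tau s ε r (rankOneParam v) (rankOneParam_ne_zero v)).Isomorphic
      (tau s ε' r' (rankOneParam v') (rankOneParam_ne_zero v'))) :
    ε = ε' ∧ r = r' ∧ SignedPermRel s r v v' := by
  obtain ⟨Φ, hσ, hB⟩ := h
  obtain ⟨hε, a, ha, π, hπ⟩ := TauAlg.eq_and_exists_perm_of_equiv (l := rankOneParam v)
    (l' := rankOneParam v') v.2.2 rfl v'.2.2 rfl v.pos Φ hσ hB
  replace hπ : ∀ α, epsSign r' (π α) * v'.1 (π α) ^ 2 * a ^ 2 = epsSign r α * v.1 α ^ 2 := hπ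
  have hsign : ∀ α, ((π α : Fin s) : ℕ) < r' ↔ (α : ℕ) < r := by
    intro α
    have p1 : 0 < v.1 α ^ 2 := by have := v.2.2 α; positivity
    have p2 : 0 < v'.1 (π α) ^ 2 * a ^ 2 := by have := v'.2.2 (π α); positivity
    -- The squares are positive, so `hπ` equates the signs of `ε_{π α}` and `ε_α`.
    rw [← epsSign_neg_iff (α := π α), ← epsSign_neg_iff (α := α),
      ← mul_lt_mul_iff_left₀ (b := epsSign r α) p1, ← hπ, mul_assoc, zero_mul,
      ← mul_lt_mul_iff_left₀ (b := epsSign r' (π α)) p2, zero_mul]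
  have hrr : r = r' := by
    rw [← card_lt_val hr, ← card_lt_val hr']
    exact Fintype.card_congr (π.subtypeEquiv fun α => (hsign α).symm)
  subst hrr
  have hsq : ∀ α, v'.1 (π α) ^ 2 * a ^ 2 = v.1 α ^ 2 := fun α => by
    have h := hπ α
    rw [TauAlg.epsSign_perm hsign, mul_assoc] at h
    exact mul_left_cancel₀ (epsSign_ne_zero r α) h
  -- Summing `hsq` over all indices compares two unit vectors.
  have ha1 : a ^ 2 = 1 := by
    have h := sum_sq_eq_one v
    rw [← Finset.sum_congr rfl fun α _ => hsq α, ← Finset.sum_mul,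
      Equiv.sum_comp π fun α => v'.1 α ^ 2, sum_sq_eq_one, one_mul] at h
    exact h
  have hu : ∀ α, ∃ u : ℤˣ, v'.1 (π α) = ((u : ℤ) : ℝ) * v.1 α := by
    intro α
    have h := hsq α
    rw [ha1, mul_one] at h
    rcases sq_eq_sq_iff_eq_or_eq_neg.mp h with h | h
    · exact ⟨1, by simp [h]⟩
    · exact ⟨-1, by simp [h]⟩
  choose u hu using hu
  exact ⟨hε, rfl, π, u, hsign, hu⟩

theorem isomorphic_of_signedPermRel {s : ℕ} (ε : ℤˣ) {r : ℕ} {v v' : GenericUnit s}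
    (h : SignedPermRel s r v v') :
    (tau s ε r (rankOneParam v) (rankOneParam_ne_zero v)).Isomorphic
      (tau s ε r (rankOneParam v') (rankOneParam_ne_zero v')) := by
  obtain ⟨π, u, hr, h⟩ := h
  refine TauAlg.isomorphic_of_signed_perm _ _ π u hr fun i α => ?_
  fin_cases i
  · exact h α
  · simp [rankOneParam]

/-- The row space is a line; `w` spans it and `c` holds the coefficients of the two rows. -/
theorem exists_eq_mul_of_rank_eq_one {s : ℕ} {l : Fin 2 → Fin s → ℝ}
    (h : (Matrix.of l).rank = 1) : ∃ (c : Fin 2 → ℝ) (w : Fin s → ℝ), ∀ i α, l i α = c i * w α := by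
  rw [Matrix.rank_eq_finrank_span_row] at h
  obtain ⟨w, -, hw⟩ := finrank_eq_one_iff'.mp h
  choose c hc using fun i => hw ⟨l i, Submodule.subset_span ⟨i, rfl⟩⟩
  refine ⟨c, w.1, fun i α => ?_⟩
  exact (congrFun (congrArg Subtype.val (hc i)) α).symm

theorem rank_rankOneParam {s : ℕ} (v : GenericUnit s) : (Matrix.of (rankOneParam v)).rank = 1 := by
  have hmul : Matrix.of (rankOneParam v) = Matrix.vecMulVec ![1, 0] v.1 := by
    ext i α
    fin_cases i <;> simp [rankOneParam, Matrix.vecMulVec_apply]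
  apply le_antisymm
  · rw [hmul]
    exact Matrix.rank_vecMulVec_le _ _
  · rw [Nat.one_le_iff_ne_zero]
    intro h
    rw [Matrix.rank_eq_finrank_span_row, Submodule.finrank_eq_zero, Submodule.span_eq_bot] at h
    exact v.2.2 _ (congrFun (h _ ⟨0, rfl⟩) ⟨0, v.pos⟩)

/-- Every triple `tau` of rank one is isomorphic to one with parameters `(λ_1, 0)`, where `λ_1` is
a unit vector. -/
theorem exists_isomorphic_rankOneParam {s : ℕ} (ε : ℤˣ) (r : ℕ) {l : Fin 2 → Fin s → ℝ}
    (hl : ∀ α, ∃ i, l i α ≠ 0) (h : (Matrix.of l).rank = 1) : ∃ v : GenericUnit s,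
      (tau s ε r l hl).Isomorphic
        (tau s ε r (rankOneParam v) (rankOneParam_ne_zero v)) := by
  obtain ⟨c, w, hcw⟩ := exists_eq_mul_of_rank_eq_one h
  have hs : 0 < s := by
    rcases Nat.eq_zero_or_pos s with rfl | hs
    · have := (Matrix.of l).rank_le_width
      omega
    · exact hs
  have hw : ∀ α, w α ≠ 0 := fun α hα => by
    obtain ⟨i, hi⟩ := hl α
    exact hi (by rw [hcw, hα, mul_zero])
  have hq : c 0 ^ 2 + c 1 ^ 2 ≠ 0 := by
    obtain ⟨i, hi⟩ := hl ⟨0, hs⟩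
    rw [hcw] at hi
    have hi' := left_ne_zero_of_mul hi
    fin_cases i
    · have : 0 < c 0 ^ 2 := by positivity
      positivity
    · have : 0 < c 1 ^ 2 := by positivity
      positivity
  have hW : WithLp.toLp 2 w ≠ 0 := fun h0 => hw ⟨0, hs⟩ (congrArg (fun x => x ⟨0, hs⟩) h0)
  have hN : ‖WithLp.toLp 2 w‖ ≠ 0 := norm_ne_zero_iff.mpr hW
  set N : ℝ := ‖WithLp.toLp 2 w‖
  let v : GenericUnit s := ⟨N⁻¹ • WithLp.toLp 2 w,
    by rw [mem_sphere_zero_iff_norm, norm_smul, norm_inv, norm_norm, inv_mul_cancel₀ hN],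
    fun α => by simpa using ⟨hN, hw α⟩⟩
  have hv : ∀ α, rankOneParam v 0 α = N⁻¹ * w α := fun α => rfl
  have hv1 : ∀ α, rankOneParam v 1 α = 0 := fun α => rfl
  -- The rows of the matrix send `c` to `N⁻¹` and to `0`; the factor `N` in the second row makes the
  -- determinant `1`.
  refine ⟨v, TauAlg.isomorphic_of_det_eq_one hl (rankOneParam_ne_zero v)
    (N⁻¹ * c 0 / (c 0 ^ 2 + c 1 ^ 2)) (N⁻¹ * c 1 / (c 0 ^ 2 + c 1 ^ 2)) (-(N * c 1)) (N * c 0)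
    ?_ (fun α => ?_) fun α => ?_⟩
  · field_simp
    ring
  · rw [hv, hcw, hcw]
    field_simp
  · rw [hv1, hcw, hcw]
    ring

/-! ### The bijection with the parameters. -/

theorem isoClass_mem_rankOneClasses (n : ℕ) (ε : ℤˣ) (r : Fin (n - 4 + 1))
    (v : GenericUnit (n - 4)) : SymmetricTriple.isoClass
      (tau (n - 4) ε r (rankOneParam v) (rankOneParam_ne_zero v)) ∈ RankOneClasses n :=
  ⟨ε, r, _, _, rank_rankOneParam v, TauAlg.indecomposable_of_zero v.2.2 rfl v.pos _, rfl⟩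

/-- The map `(ε_Y, r, [λ_1]) ↦ [τ_n(ε_Y, r, (λ_1, 0))]`. -/
noncomputable def rankOneClassOf (n : ℕ)
    (p : ℤˣ × Σ r : Fin (n - 4 + 1), SignedPermClass (n - 4) r) : RankOneClasses n :=
  Quotient.lift
    (fun v : GenericUnit (n - 4) => (⟨_, isoClass_mem_rankOneClasses n p.1 p.2.1 v⟩ :
      RankOneClasses n))
    (fun _ _ h => Subtype.ext (Quotient.sound (isomorphic_of_signedPermRel p.1 h))) p.2.2

theorem rankOneClassOf_bijective (n : ℕ) : Function.Bijective (rankOneClassOf n) := by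
  constructor
  · rintro ⟨ε, r, q⟩ ⟨ε', r', q'⟩ h
    induction q using Quotient.inductionOn with | _ v => ?_
    induction q' using Quotient.inductionOn with | _ v' => ?_
    obtain ⟨rfl, hr, hv⟩ := signedPermRel_of_isomorphic (Nat.lt_succ_iff.mp r.2)
      (Nat.lt_succ_iff.mp r'.2) (Quotient.exact (congrArg Subtype.val h))
    obtain rfl := Fin.ext hr
    rw [Quotient.sound (s := signedPermSetoid (n - 4) r) hv]
  · rintro ⟨c, ε, r, l, hl, hrank, -, rfl⟩
    obtain ⟨v, hv⟩ := exists_isomorphic_rankOneParam ε r hl hrank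
    exact ⟨(ε, ⟨r, Quotient.mk (signedPermSetoid (n - 4) r) v⟩),
      Subtype.ext (Quotient.sound (SymmetricTriple.isomorphic_equivalence.symm hv))⟩

theorem mainTheorem4 (n : ℕ) (hn : 4 ≤ n) :
    (∃ Ψ : (ℤˣ × Σ r : Fin (n - 4 + 1), SignedPermClass (n - 4) r) ≃ RankOneClasses n,
      ∀ (ε : ℤˣ) (r : Fin (n - 4 + 1)) (v : GenericUnit (n - 4)),
        (Ψ (ε, ⟨r, Quotient.mk (signedPermSetoid (n - 4) r) v⟩) : SymmetricTriple.IsoClass) =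
          SymmetricTriple.isoClass
            (tau (n - 4) ε r (rankOneParam v) (rankOneParam_ne_zero v))) ∧
    ((RankOneClasses n).Nonempty → 4 < n) := by
  refine ⟨⟨Equiv.ofBijective _ (rankOneClassOf_bijective n), fun _ _ _ => rfl⟩, ?_⟩
  rintro ⟨c, ε, r, l, hl, hrank, -⟩
  -- A matrix of rank `1` has at least one column, so `n - 4` is positive.
  have := (Matrix.of l).rank_le_width
  omega
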